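/- There is an absolute constant $c>0$ such that for every $N\in\mathbb{N}$ there are an $n\ge N$ and a connected outer-1-plane graph $G$ with $n$ vertices, whose embedding can moreover be given by a straight-line drawing, such that every embedding-preserving bar visibility representation of $G$ has area at least $c\,n^2$ (i.e. area $\Omega(n^2)$). Here an outer-1-plane graph is a graph with a fixed embedding given by a drawing in the plane in which each edge is crossed at most once and all vertices lie on the boundary of the outer face. A bar visibility representation assigns to the vertices disjoint horizontal segments, possibly single points (bars), and to each edge a horizontal or vertical segment that joins the bars of its endpoints and meets bars only in its two ends; all ends of bars and of edge-segments have integer coordinates. It is embedding-preserving if the incident edges have the same cyclic order around each vertex as in the embedding, and the planarization (obtained by replacing crossings by dummy vertices) has the same facial circuits. Its area is the number of grid columns times the number of grid rows that it intersects. -/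

import Mathlib

/-- The determinant of two vectors of the plane (positive iff the direction of `q` is obtained from
that of `p` by a counterclockwise turn by an angle strictly between `0` and `π`). -/
def det2 (p q : ℝ × ℝ) : ℝ := p.1 * q.2 - p.2 * q.1

/-- The directions of the vectors `p`, `q`, `r` are pairwise distinct and are met in this cyclic
order in a counterclockwise turn. (The three angles of such a turn sum to `2π` and at most one of
them is `≥ π`; in the opposite cyclic order, or with equal directions, at most one of the three
determinants is positive.) -/
def CCW (p q r : ℝ × ℝ) : Prop :=
  (0 < det2 p q ∧ 0 < det2 q r) ∨ (0 < det2 q r ∧ 0 < det2 r p) ∨ (0 < det2 r p ∧ 0 < det2 p q)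

/-- What straight-line drawings and visibility representations of a graph `G` have in common: every
edge `uv` is drawn as the straight segment from its attachment point `att u v` at `u` to its
attachment point `att v u` at `v`, and around every vertex `v` there is a counterclockwise cyclic
order of the incident edges: `rot v a b c` says that the edges `va`, `vb`, `vc` are distinct and met
in this cyclic order. (Values of `att` and `rot` at non-adjacent vertices are never used.) -/
structure SegmentLayout {V : Type*} (G : SimpleGraph V) where
  att : V → V → ℝ × ℝ
  rot : V → V → V → V → Prop

namespace SegmentLayout

variable {V : Type*} {G : SimpleGraph V} (L : SegmentLayout G)

/-- The edges `uv` and `wz` cross in the point `p`. -/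
def CrossAt (u v w z : V) (p : ℝ × ℝ) : Prop :=
  G.Adj u v ∧ G.Adj w z ∧
    p ∈ openSegment ℝ (L.att u v) (L.att v u) ∧ p ∈ openSegment ℝ (L.att w z) (L.att z w) ∧
    det2 (L.att v u - L.att u v) (L.att z w - L.att w z) ≠ 0

end SegmentLayout

/-- The vertices of a planarization: the vertices of the graph, and one dummy vertex for every
crossing, named by the unordered pair of the two edges that cross. (Two straight segments that are
not parallel meet at most once.) -/
abbrev PlanarizationNode (V : Type*) := V ⊕ Sym2 (Sym2 V)

namespace SegmentLayout

variable {V : Type*} {G : SimpleGraph V} (L : SegmentLayout G)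

/-- The node `x` of the planarization lies on the edge `uv`, in the point `p`: it is an end of the
edge, or the dummy vertex of a crossing of the edge. -/
def NodeAt (u v : V) (x : PlanarizationNode V) (p : ℝ × ℝ) : Prop :=
  (x = Sum.inl u ∧ p = L.att u v) ∨ (x = Sum.inl v ∧ p = L.att v u) ∨
    ∃ w z, L.CrossAt u v w z p ∧ x = Sum.inr s(s(u, v), s(w, z))

/-- Going along the edge `uv` from `u` to `v`, the node `y` (in the point `q`) comes immediately
after the node `x` (in the point `p`). -/
def Piece (u v : V) (x y : PlanarizationNode V) (p q : ℝ × ℝ) : Prop :=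
  G.Adj u v ∧ L.NodeAt u v x p ∧ L.NodeAt u v y q ∧ p ≠ q ∧ p ∈ segment ℝ (L.att u v) q ∧
    ∀ z r, L.NodeAt u v z r → r ∉ openSegment ℝ p q

/-- Adjacency in the planarization. -/
def PAdj (x y : PlanarizationNode V) : Prop := ∃ u v p q, L.Piece u v x y p q

/-- The counterclockwise cyclic order of the neighbours of a node `x` in the planarization. -/
def PRot : PlanarizationNode V → PlanarizationNode V → PlanarizationNode V →
    PlanarizationNode V → Prop
  | Sum.inl v, y₁, y₂, y₃ => ∃ a₁ a₂ a₃,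
      (∃ p q, L.Piece v a₁ (Sum.inl v) y₁ p q) ∧ (∃ p q, L.Piece v a₂ (Sum.inl v) y₂ p q) ∧
      (∃ p q, L.Piece v a₃ (Sum.inl v) y₃ p q) ∧ L.rot v a₁ a₂ a₃
  | Sum.inr e, y₁, y₂, y₃ => ∃ p q₁ q₂ q₃,
      (∃ u v, L.Piece u v (Sum.inr e) y₁ p q₁) ∧ (∃ u v, L.Piece u v (Sum.inr e) y₂ p q₂) ∧
      (∃ u v, L.Piece u v (Sum.inr e) y₃ p q₃) ∧ CCW (q₁ - p) (q₂ - p) (q₃ - p)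

/-- One step along the boundary of a face that is kept on the left: after the directed edge
`(x, y)` of the planarization comes the directed edge `(y, z)`, where `yz` is the edge that follows
`yx` in clockwise order around `y` (it is `yx` itself only if `y` has degree one). -/
def FaceStep (d d' : PlanarizationNode V × PlanarizationNode V) : Prop :=
  d'.1 = d.2 ∧ L.PAdj d.1 d.2 ∧ L.PAdj d.2 d'.2 ∧
    (d'.2 = d.1 → ∀ w, L.PAdj d.2 w → w = d.1) ∧ ∀ w, ¬ L.PRot d.2 d'.2 w d.1

/-- The circuits that bound the faces of the planarization, as cyclic sequences of directed
edges. -/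
def facialCircuits : Set (Cycle (PlanarizationNode V × PlanarizationNode V)) :=
  {c | c ≠ Cycle.nil ∧ c.Nodup ∧ c.Chain L.FaceStep}

/-- The layouts `L` and `M` of `G` have the same embedding: the incident edges have the same cyclic
order around each vertex, and the planarizations are the same graph with the same facial
circuits. -/
def SameEmbedding (L M : SegmentLayout G) : Prop :=
  (∀ v a b c, G.Adj v a → G.Adj v b → G.Adj v c → (L.rot v a b c ↔ M.rot v a b c)) ∧
    (∀ x y, L.PAdj x y ↔ M.PAdj x y) ∧ L.facialCircuits = M.facialCircuits

end SegmentLayout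

/-- A straight-line drawing of `G` in the plane: the vertices are distinct points and no edge
contains a vertex that is not one of its ends. -/
structure StraightLineDrawing {V : Type*} (G : SimpleGraph V) where
  pos : V → ℝ × ℝ
  pos_injective : Function.Injective pos
  notMem_edge : ∀ u v w, G.Adj u v → w ≠ u → w ≠ v → pos w ∉ segment ℝ (pos u) (pos v)

namespace StraightLineDrawing

variable {V : Type*} {G : SimpleGraph V} (D : StraightLineDrawing G)

/-- The segments and cyclic orders of a straight-line drawing. -/
def toLayout : SegmentLayout G where
  att u _ := D.pos u
  rot v a b c := CCW (D.pos a - D.pos v) (D.pos b - D.pos v) (D.pos c - D.pos v)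

/-- All points of the plane that the drawing uses. -/
def support : Set (ℝ × ℝ) :=
  Set.range D.pos ∪ {p | ∃ u v, G.Adj u v ∧ p ∈ segment ℝ (D.pos u) (D.pos v)}

/-- The outer face: the unbounded region of the complement of the drawing. -/
def outerFace : Set (ℝ × ℝ) :=
  {q | q ∈ D.supportᶜ ∧ ¬ Bornology.IsBounded (connectedComponentIn D.supportᶜ q)}

/-- The drawing is outer-1-planar: each edge is crossed by at most one other edge, and all vertices
lie on the boundary of the outer face. -/
def IsOuter1Planar : Prop :=
  (∀ u v w z w' z' p p', D.toLayout.CrossAt u v w z p → D.toLayout.CrossAt u v w' z' p' →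
    s(w, z) = s(w', z')) ∧
  ∀ v, D.pos v ∈ frontier D.outerFace

end StraightLineDrawing

/-- A (bi-directional) bar visibility representation of `G` on the integer grid: every vertex is a
bar, i.e. a horizontal segment (possibly a single point) from `(left v, row v)` to
`(right v, row v)`, the bars are disjoint, and every edge `uv` is a horizontal or vertical segment
from a grid point `att u v` of the bar of `u` to a grid point `att v u` of the bar of `v` that meets
these two bars in no other point and meets no other bar.

All points are grid points: as all corners are integral and all segments axis-parallel, two of the
segments meet in the real plane iff they share a grid point. The interval `Set.uIcc p q` of `ℤ × ℤ`
is the set of grid points of the axis-parallel segment from `p` to `q`. -/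
structure BarVisibilityRep {V : Type*} (G : SimpleGraph V) where
  row : V → ℤ
  left : V → ℤ
  right : V → ℤ
  left_le_right : ∀ v, left v ≤ right v
  att : V → V → ℤ × ℤ
  disjoint_bars : ∀ u v, u ≠ v →
    Disjoint (Set.Icc (left u, row u) (right u, row u)) (Set.Icc (left v, row v) (right v, row v))
  axis_parallel : ∀ u v, G.Adj u v →
    (att u v).1 = (att v u).1 ∨ (att u v).2 = (att v u).2
  edge_inter_bar : ∀ u v, G.Adj u v →
    Set.uIcc (att u v) (att v u) ∩ Set.Icc (left u, row u) (right u, row u) = {att u v}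
  edge_disjoint_bar : ∀ u v w, G.Adj u v → w ≠ u → w ≠ v →
    Disjoint (Set.uIcc (att u v) (att v u)) (Set.Icc (left w, row w) (right w, row w))

namespace BarVisibilityRep

variable {V : Type*} {G : SimpleGraph V} (Γ : BarVisibilityRep G)

/-- The place of the edge `va` in a counterclockwise walk around the (slightly thickened) bar of
`v`: first the right end, then the upper side from right to left, then the left end, then the lower
side from left to right. -/
def place (v a : V) : ℤ :=
  if (Γ.att v a).1 = (Γ.att a v).1 then
    if (Γ.att v a).2 < (Γ.att a v).2 then
      1 + (Γ.right v - (Γ.att v a).1)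
    else
      (Γ.right v - Γ.left v) + 3 + ((Γ.att v a).1 - Γ.left v)
  else
    if (Γ.att v a).1 < (Γ.att a v).1 then 0 else (Γ.right v - Γ.left v) + 2

/-- The segments and cyclic orders of a bar visibility representation. -/
def toLayout : SegmentLayout G where
  att u v := (((Γ.att u v).1 : ℝ), ((Γ.att u v).2 : ℝ))
  rot v a b c :=
    (Γ.place v a < Γ.place v b ∧ Γ.place v b < Γ.place v c) ∨
    (Γ.place v b < Γ.place v c ∧ Γ.place v c < Γ.place v a) ∨
    (Γ.place v c < Γ.place v a ∧ Γ.place v a < Γ.place v b)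

/-- The representation preserves the embedding that is given by the drawing `D`. (No edge crosses a
vertex in any bar visibility representation.) -/
def EmbeddingPreserving (D : StraightLineDrawing G) : Prop :=
  Γ.toLayout.SameEmbedding D.toLayout

/-- All grid points that the representation uses. -/
def support : Set (ℤ × ℤ) :=
  {p | (∃ v, p ∈ Set.Icc (Γ.left v, Γ.row v) (Γ.right v, Γ.row v)) ∨
    ∃ u v, G.Adj u v ∧ p ∈ Set.uIcc (Γ.att u v) (Γ.att v u)}

/-- The number of grid columns that meet the representation. -/
noncomputable def width : ℕ := {x : ℤ | ∃ y, (x, y) ∈ Γ.support}.ncard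

/-- The number of grid rows that meet the representation. -/
noncomputable def height : ℕ := {y : ℤ | ∃ x, (x, y) ∈ Γ.support}.ncard

/-- The area is the width times the height. -/
noncomputable def area : ℕ := Γ.width * Γ.height

end BarVisibilityRep

/-!
The graph is a union of kites, that is, of complete graphs on four vertices whose diagonals cross.
Its vertices are points of a parabola, so all of them lie on the outer face, and two edges cross
exactly if their ends interleave. Any two kites are nested or side by side (`IsKiteFamily`), so the
only crossings are those of the two diagonals of a kite
(`isOuter1Planar_parabolaDrawing`).

An embedding-preserving representation has the same planarization, hence the same crossings. Where
two axis-parallel segments cross, one is horizontal and the other is vertical. Therefore in every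
kite one diagonal joins two bars of the same row, and the ends of the other one lie strictly above
and strictly below this row (`crossedRows_of_kite`). On the other hand, a bar has at most two
neighbours in its own row, one beyond each of its ends (`not_three_neighbors_in_row`).
No further property of the embedding is needed.

A vertex with two neighbours in its row is saturated: in all other kites its diagonal is
vertical, so the other diagonal is horizontal, which uses up ends of other bars. The kites are
arranged so that saturation spreads along a ladder of `k` kites and forces the rows along it to be
strictly monotone (`RungForced.succ`, `exists_injOn`). To get a saturated vertex to start from, take
three pairs of kites in a fan around the vertex `0`: at most two kites of the fan have a horizontal
diagonal at `0`, so one pair has none, and the vertex shared by this pair is saturated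
(`exists_saturated`). Hence the height is at least `k + 1`. Finally, `0` has more than `2 * k`
neighbours, and the vertical edges on one side of its bar lie in distinct columns, so the width is
at least `k`. The graph has `20 * k + 20` vertices.
-/

/-! ### Straight-line drawings with all vertices on a parabola -/

/-- The point of the parabola `y = x ^ 2` above `x`. -/
def parabolaPoint (x : ℝ) : ℝ × ℝ := (x, x ^ 2)

theorem mem_openSegment_parabola {u v : ℝ} (huv : u < v) {p : ℝ × ℝ} :
    p ∈ openSegment ℝ (parabolaPoint u) (parabolaPoint v) ↔
      u < p.1 ∧ p.1 < v ∧ p.2 = (u + v) * p.1 - u * v := by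
  constructor
  · rintro ⟨s, t, hs, ht, hst, rfl⟩
    obtain rfl : s = 1 - t := by linarith
    simp only [parabolaPoint, Prod.smul_mk, Prod.mk_add_mk, smul_eq_mul]
    refine ⟨?_, ?_, ?_⟩
    · nlinarith
    · nlinarith
    · ring
  · rintro ⟨h1, h2, h3⟩
    have h : v - u ≠ 0 := by linarith
    refine ⟨(v - p.1) / (v - u), (p.1 - u) / (v - u), ?_, ?_, ?_, ?_⟩
    · exact div_pos (by linarith) (by linarith)
    · exact div_pos (by linarith) (by linarith)
    · field_simp
      ring
    · ext
      · simp only [parabolaPoint, Prod.smul_mk, Prod.mk_add_mk, smul_eq_mul]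
        field_simp
        ring
      · simp only [parabolaPoint, Prod.smul_mk, Prod.mk_add_mk, smul_eq_mul, h3]
        field_simp
        ring

theorem det2_parabola (u v w z : ℝ) :
    det2 (parabolaPoint v - parabolaPoint u) (parabolaPoint z - parabolaPoint w) =
      (v - u) * (z - w) * (z + w - v - u) := by
  simp only [det2, parabolaPoint, Prod.mk_sub_mk]
  ring

/-- Chords of a parabola that cross properly have interleaving ends: on a chord, `y - x ^ 2` is
`(x - u) * (v - x)`, which is smaller on a nested chord. -/
theorem interleave_of_mem_openSegment {u v w z : ℝ} (huv : u < v) (hwz : w < z) {p : ℝ × ℝ}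
    (h₁ : p ∈ openSegment ℝ (parabolaPoint u) (parabolaPoint v))
    (h₂ : p ∈ openSegment ℝ (parabolaPoint w) (parabolaPoint z)) (hne : z + w - v - u ≠ 0) :
    (u < w ∧ w < v ∧ v < z) ∨ (w < u ∧ u < z ∧ z < v) := by
  obtain ⟨a1, a2, a3⟩ := (mem_openSegment_parabola huv).1 h₁
  obtain ⟨b1, b2, b3⟩ := (mem_openSegment_parabola hwz).1 h₂
  have key : (p.1 - u) * (v - p.1) = (p.1 - w) * (z - p.1) := by linarith
  rcases lt_trichotomy u w with h | h | h
  · refine Or.inl ⟨h, by linarith, ?_⟩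
    by_contra! hv
    nlinarith [mul_pos (sub_pos.2 h) (sub_pos.2 a2), mul_nonneg (sub_nonneg.2 hv) (sub_pos.2 b1).le]
  · subst h
    exact absurd (by linarith [mul_left_cancel₀ (sub_pos.2 a1).ne' key]) hne
  · refine Or.inr ⟨h, by linarith, ?_⟩
    by_contra! hv
    nlinarith [mul_pos (sub_pos.2 h) (sub_pos.2 b2), mul_nonneg (sub_nonneg.2 hv) (sub_pos.2 a1).le]

/-- Chords of a parabola with interleaving ends cross properly. -/
theorem exists_mem_openSegment {a b c d : ℝ} (hab : a < b) (hbc : b < c) (hcd : c < d) :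
    ∃ p, p ∈ openSegment ℝ (parabolaPoint a) (parabolaPoint c) ∧
      p ∈ openSegment ℝ (parabolaPoint b) (parabolaPoint d) := by
  have hD : 0 < b + d - a - c := by linarith
  set x := (b * d - a * c) / (b + d - a - c)
  have hxD : x * (b + d - a - c) = b * d - a * c := div_mul_cancel₀ _ hD.ne'
  have pos {y e f : ℝ} (he : 0 < e) (hf : 0 < f) (h : y * (b + d - a - c) = e * f) : 0 < y :=
    pos_of_mul_pos_left (h ▸ mul_pos he hf) hD.le
  have h1 : 0 < x - a := pos (sub_pos.2 hab) (sub_pos.2 (hab.trans (hbc.trans hcd)))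
    (by linear_combination hxD)
  have h2 : 0 < c - x := pos (sub_pos.2 hbc) (sub_pos.2 hcd) (by linear_combination -hxD)
  have h3 : 0 < x - b := pos (sub_pos.2 hab) (sub_pos.2 hbc) (by linear_combination hxD)
  have h4 : 0 < d - x := pos (sub_pos.2 (hab.trans (hbc.trans hcd))) (sub_pos.2 hcd)
    (by linear_combination -hxD)
  refine ⟨(x, (a + c) * x - a * c), (mem_openSegment_parabola (hab.trans hbc)).2 ⟨?_, ?_, rfl⟩,
    (mem_openSegment_parabola (hbc.trans hcd)).2 ⟨?_, ?_, ?_⟩⟩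
  · simpa using h1
  · simpa using h2
  · simpa using h3
  · simpa using h4
  · simp only
    linear_combination -hxD

theorem parabola_notMem_segment {u v w : ℝ} (hu : w ≠ u) (hv : w ≠ v) :
    parabolaPoint w ∉ segment ℝ (parabolaPoint u) (parabolaPoint v) := by
  rintro ⟨s, t, hs, ht, hst, h⟩
  obtain rfl : s = 1 - t := by linarith
  simp only [parabolaPoint, Prod.smul_mk, Prod.mk_add_mk, smul_eq_mul, Prod.mk.injEq] at h
  obtain ⟨h1, h2⟩ := h
  have : (w - u) * (w - v) = 0 := by
    rw [← h1] at h2 ⊢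
    linear_combination -h2
  rcases mul_eq_zero.1 this with h | h
  · exact hu (by linarith)
  · exact hv (by linarith)

theorem sq_le_of_mem_segment_parabola {u v : ℝ} {p : ℝ × ℝ}
    (h : p ∈ segment ℝ (parabolaPoint u) (parabolaPoint v)) : p.1 ^ 2 ≤ p.2 := by
  obtain ⟨s, t, hs, ht, hst, rfl⟩ := h
  obtain rfl : s = 1 - t := by linarith
  simp only [parabolaPoint, Prod.smul_mk, Prod.mk_add_mk, smul_eq_mul]
  nlinarith [mul_nonneg (mul_nonneg hs ht) (sq_nonneg (u - v))]

/-- The straight-line drawing of a graph on `{0, …, n - 1}` that puts the vertex `i` at the point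
`(i, i ^ 2)`. -/
def parabolaDrawing {n : ℕ} (G : SimpleGraph (Fin n)) : StraightLineDrawing G where
  pos i := parabolaPoint (i : ℕ)
  pos_injective i j h := by
    have h1 : ((i : ℕ) : ℝ) = (j : ℕ) := congrArg Prod.fst h
    exact Fin.ext (by exact_mod_cast h1)
  notMem_edge u v w _ hu hv := parabola_notMem_segment
    (fun h => hu (Fin.ext (by exact_mod_cast h))) (fun h => hv (Fin.ext (by exact_mod_cast h)))

/-- The region below the parabola is connected, unbounded and avoids the drawing, and every vertex
lies on its boundary. -/
theorem parabolaDrawing_mem_frontier {n : ℕ} (G : SimpleGraph (Fin n)) (v : Fin n) :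
    (parabolaDrawing G).pos v ∈ frontier (parabolaDrawing G).outerFace := by
  set D := parabolaDrawing G with hD
  have hsup : ∀ p ∈ D.support, p.1 ^ 2 ≤ p.2 := by
    rintro p (⟨i, rfl⟩ | ⟨i, j, -, hp⟩)
    · exact le_rfl
    · exact sq_le_of_mem_segment_parabola hp
  set B : Set (ℝ × ℝ) := (fun q : ℝ × ℝ => (q.1, q.1 ^ 2 - q.2)) '' (Set.univ ×ˢ Set.Ioi 0) 
  have hBD : B ⊆ D.supportᶜ := by
    rintro _ ⟨q, ⟨-, hq⟩, rfl⟩ hmem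
    have h0 : (0 : ℝ) < q.2 := hq
    have := hsup _ hmem
    simp only at this
    linarith
  have hBconn : IsPreconnected B :=
    (isPreconnected_univ.prod isPreconnected_Ioi).image _ (by fun_prop)
  have hBunb : ¬ Bornology.IsBounded B := by
    intro hb
    obtain ⟨R, hR⟩ := (hb.image_fst).exists_norm_le
    have := hR (|R| + 1)
      ⟨(|R| + 1, (|R| + 1) ^ 2 - 1), ⟨(|R| + 1, 1), ⟨trivial, zero_lt_one' ℝ⟩, rfl⟩, rfl⟩
    rw [Real.norm_eq_abs, abs_of_pos (by positivity)] at this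
    linarith [le_abs_self R]
  have hBout : B ⊆ D.outerFace := fun q hq =>
    ⟨hBD hq, fun hb => hBunb (hb.subset (hBconn.subset_connectedComponentIn hq hBD))⟩
  refine ⟨closure_mono hBout ?_, fun h => (interior_subset h).1 (Or.inl ⟨v, rfl⟩)⟩
  refine mem_closure_of_tendsto (f := fun t : ℝ => (((v : ℕ) : ℝ), ((v : ℕ) : ℝ) ^ 2 - t))
    (b := nhdsWithin 0 (Set.Ioi 0)) ?_ ?_
  · refine tendsto_nhdsWithin_of_tendsto_nhds ?_
    have : Continuous fun t : ℝ => (((v : ℕ) : ℝ), ((v : ℕ) : ℝ) ^ 2 - t) := by fun_prop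
    simpa [hD, parabolaDrawing, parabolaPoint] using this.tendsto 0
  · filter_upwards [self_mem_nhdsWithin] with t ht
    exact ⟨(((v : ℕ) : ℝ), t), ⟨trivial, ht⟩, rfl⟩

/-! ### Rows in bar visibility representations -/

/-- The rows of the four corners of a kite whose diagonals `ac` and `bd` cross in a visibility
representation: one diagonal is horizontal, and the ends of the other one lie strictly above and
strictly below it. -/
def CrossedRows (ra rb rc rd : ℤ) : Prop :=
  (ra = rc ∧ (rb < ra ∧ ra < rd ∨ rd < ra ∧ ra < rb)) ∨
    (rb = rd ∧ (ra < rb ∧ rb < rc ∨ rc < rb ∧ rb < ra))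

namespace SegmentLayout

variable {V : Type*} {G : SimpleGraph V} (L : SegmentLayout G)

theorem CrossAt.swap {L : SegmentLayout G} {u v w z : V} {p : ℝ × ℝ} (h : L.CrossAt u v w z p) :
    L.CrossAt w z u v p := by
  obtain ⟨h1, h2, h3, h4, h5⟩ := h
  refine ⟨h2, h1, h4, h3, fun h => h5 ?_⟩
  simp only [det2] at h ⊢
  linarith

theorem CrossAt.reverse {L : SegmentLayout G} {u v w z : V} {p : ℝ × ℝ}
    (h : L.CrossAt u v w z p) : L.CrossAt v u w z p := by
  obtain ⟨h1, h2, h3, h4, h5⟩ := h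
  refine ⟨h1.symm, h2, openSegment_symm ℝ (L.att u v) (L.att v u) ▸ h3, h4, fun h => h5 ?_⟩
  simp only [det2, Prod.fst_sub, Prod.snd_sub] at h ⊢
  linarith

theorem CrossAt.of_sym2_eq {L : SegmentLayout G} {u v w z a b c d : V} {p : ℝ × ℝ}
    (h : L.CrossAt u v w z p) (he : s(s(a, c), s(b, d)) = s(s(u, v), s(w, z))) :
    L.CrossAt a c b d p := by
  have key : ∀ {u v w z : V}, L.CrossAt u v w z p → s(a, c) = s(u, v) → s(b, d) = s(w, z) →
      L.CrossAt a c b d p := by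
    intro u v w z h h1 h2
    rcases Sym2.eq_iff.1 h1 with ⟨rfl, rfl⟩ | ⟨rfl, rfl⟩ <;>
      rcases Sym2.eq_iff.1 h2 with ⟨rfl, rfl⟩ | ⟨rfl, rfl⟩
    · exact h
    · exact h.swap.reverse.swap
    · exact h.reverse
    · exact h.reverse.swap.reverse.swap
  rcases Sym2.eq_iff.1 he with ⟨h1, h2⟩ | ⟨h1, h2⟩
  · exact key h h1 h2
  · exact key h.swap h1 h2

/-- A dummy vertex with a neighbour in the planarization stands for a crossing. -/
theorem exists_crossAt_of_pAdj {x : PlanarizationNode V} {a b c d : V}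
    (h : L.PAdj x (Sum.inr s(s(a, c), s(b, d)))) : ∃ p, L.CrossAt a c b d p := by
  obtain ⟨u, v, p, q, -, -, hq, -⟩ := h
  rcases hq with ⟨h, -⟩ | ⟨h, -⟩ | ⟨w, z, hc, he⟩
  · cases h
  · cases h
  · exact ⟨q, hc.of_sym2_eq (Sum.inr.inj he)⟩

end SegmentLayout

namespace BarVisibilityRep

variable {V : Type*} {G : SimpleGraph V} (Γ : BarVisibilityRep G)

theorem att_mem_bar {u v : V} (h : G.Adj u v) :
    Γ.att u v ∈ Set.Icc (Γ.left u, Γ.row u) (Γ.right u, Γ.row u) :=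
  ((Γ.edge_inter_bar u v h).ge rfl).2

theorem left_le_att {u v : V} (h : G.Adj u v) : Γ.left u ≤ (Γ.att u v).1 :=
  (Γ.att_mem_bar h).1.1

theorem att_le_right {u v : V} (h : G.Adj u v) : (Γ.att u v).1 ≤ Γ.right u :=
  (Γ.att_mem_bar h).2.1

theorem att_snd {u v : V} (h : G.Adj u v) : (Γ.att u v).2 = Γ.row u :=
  le_antisymm (Γ.att_mem_bar h).2.2 (Γ.att_mem_bar h).1.2

theorem att_fst_eq {u v : V} (h : G.Adj u v) (hr : Γ.row u ≠ Γ.row v) :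
    (Γ.att u v).1 = (Γ.att v u).1 := by
  refine (Γ.axis_parallel u v h).resolve_right fun h2 => hr ?_
  rwa [Γ.att_snd h, Γ.att_snd h.symm] at h2

theorem right_lt_left_or {u v : V} (huv : u ≠ v) (hr : Γ.row u = Γ.row v) :
    Γ.right u < Γ.left v ∨ Γ.right v < Γ.left u := by
  by_contra! h
  have h1 := Γ.left_le_right u
  have h2 := Γ.left_le_right v
  refine Set.disjoint_left.1 (Γ.disjoint_bars u v huv)
    (show (max (Γ.left u) (Γ.left v), Γ.row u) ∈ _ from ?_) ?_
  · exact ⟨⟨le_max_left _ _, le_rfl⟩, ⟨max_le h1 h.1, le_rfl⟩⟩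
  · exact ⟨⟨le_max_right _ _, hr.ge⟩, ⟨max_le h.2 h2, hr.le⟩⟩

/-- A horizontal edge `uv` cannot pass the bar of `w`. -/
theorem not_between {u v w : V} (h : G.Adj u v) (hwu : w ≠ u) (hwv : w ≠ v)
    (hv : Γ.row v = Γ.row u) (hw : Γ.row w = Γ.row u)
    (h1 : Γ.right u < Γ.left w ∧ Γ.right w < Γ.left v ∨
      Γ.right v < Γ.left w ∧ Γ.right w < Γ.left u) : False := by
  have a1 := Γ.left_le_att h
  have a2 := Γ.att_le_right h
  have a3 := Γ.left_le_att h.symm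
  have a4 := Γ.att_le_right h.symm
  have a5 := Γ.left_le_right w
  refine Set.disjoint_left.1 (Γ.edge_disjoint_bar u v w h hwu hwv)
    (show (Γ.left w, Γ.row u) ∈ _ from ?_) ⟨⟨le_rfl, hw.le⟩, ⟨a5, hw.ge⟩⟩
  rw [Set.uIcc, Set.mem_Icc, Prod.le_def, Prod.le_def]
  simp only [Prod.fst_inf, Prod.snd_inf, Prod.fst_sup, Prod.snd_sup, Γ.att_snd h,
    Γ.att_snd h.symm, hv]
  omega

/-- A bar has at most two neighbours in its own row: the next bars to its left and right. -/
theorem not_three_neighbors_in_row {v a b c : V} (ha : G.Adj v a) (hb : G.Adj v b)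
    (hc : G.Adj v c) (hab : a ≠ b) (hac : a ≠ c) (hbc : b ≠ c) (hra : Γ.row a = Γ.row v)
    (hrb : Γ.row b = Γ.row v) (hrc : Γ.row c = Γ.row v) : False := by
  have two : ∀ {x y : V}, G.Adj v x → G.Adj v y → x ≠ y → Γ.row x = Γ.row v →
      Γ.row y = Γ.row v → ¬ (Γ.right v < Γ.left x ∧ Γ.right v < Γ.left y) ∧
        ¬ (Γ.right x < Γ.left v ∧ Γ.right y < Γ.left v) := by
    intro x y hx hy hxy hrx hry
    have h1 := Γ.left_le_right x
    have h2 := Γ.left_le_right y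
    refine ⟨fun h => ?_, fun h => ?_⟩ <;>
      rcases Γ.right_lt_left_or hxy (hrx.trans hry.symm) with h' | h'
    · exact Γ.not_between hy hx.ne' hxy hry hrx (Or.inl ⟨h.1, h'⟩)
    · exact Γ.not_between hx hy.ne' hxy.symm hrx hry (Or.inl ⟨h.2, h'⟩)
    · exact Γ.not_between hx hy.ne' hxy.symm hrx hry (Or.inr ⟨h', h.2⟩)
    · exact Γ.not_between hy hx.ne' hxy hry hrx (Or.inr ⟨h', h.1⟩)
  have h1 := two ha hb hab hra hrb
  have h2 := two ha hc hac hra hrc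
  have h3 := two hb hc hbc hrb hrc
  have h4 := Γ.right_lt_left_or ha.ne hra.symm
  have h5 := Γ.right_lt_left_or hb.ne hrb.symm
  have h6 := Γ.right_lt_left_or hc.ne hrc.symm
  tauto

theorem crossedRows_of_crossAt {a b c d : V} {p : ℝ × ℝ}
    (h : Γ.toLayout.CrossAt a c b d p) :
    CrossedRows (Γ.row a) (Γ.row b) (Γ.row c) (Γ.row d) := by
  -- A horizontal edge `ac` can only be crossed by an edge `bd` between rows on both sides of it.
  have key : ∀ {a b c d : V}, Γ.toLayout.CrossAt a c b d p → Γ.row a = Γ.row c →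
      Γ.row b < Γ.row a ∧ Γ.row a < Γ.row d ∨ Γ.row d < Γ.row a ∧ Γ.row a < Γ.row b := by
    intro a b c d h hr
    obtain ⟨h1, h2, ⟨s, t, hs, ht, hst, rfl⟩, ⟨s', t', hs', ht', hst', hp⟩, hdet⟩ := h
    have hp2 := congrArg Prod.snd hp
    simp only [toLayout, det2, Prod.fst_sub, Prod.snd_sub, Prod.snd_add, Prod.smul_snd,
      smul_eq_mul, Γ.att_snd h1, Γ.att_snd h1.symm, Γ.att_snd h2, Γ.att_snd h2.symm, ← hr]
      at hp2 hdet
    have hp3 : (Γ.row a : ℝ) = s' * Γ.row b + t' * Γ.row d := by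
      rw [hp2, ← add_mul, hst, one_mul]
    have hs'' : s' = 1 - t' := by linarith
    subst hs''
    rcases lt_trichotomy (Γ.row b) (Γ.row d) with hlt | heq | hlt
    · have : (Γ.row b : ℝ) < Γ.row d := by exact_mod_cast hlt
      refine Or.inl ⟨?_, ?_⟩
      · have : (Γ.row b : ℝ) < Γ.row a := by nlinarith
        exact_mod_cast this
      · have : (Γ.row a : ℝ) < Γ.row d := by nlinarith
        exact_mod_cast this
    · rw [heq] at hdet
      simp at hdet
    · have : (Γ.row d : ℝ) < Γ.row b := by exact_mod_cast hlt
      refine Or.inr ⟨?_, ?_⟩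
      · have : (Γ.row d : ℝ) < Γ.row a := by nlinarith
        exact_mod_cast this
      · have : (Γ.row a : ℝ) < Γ.row b := by nlinarith
        exact_mod_cast this
  by_cases hac : Γ.row a = Γ.row c
  · exact Or.inl ⟨hac, key h hac⟩
  by_cases hbd : Γ.row b = Γ.row d
  · exact Or.inr ⟨hbd, key h.swap hbd⟩
  -- Two vertical edges are parallel.
  · obtain ⟨h1, h2, -, -, hdet⟩ := h
    refine absurd ?_ hdet
    simp [toLayout, det2, Γ.att_fst_eq h1 hac, Γ.att_fst_eq h2 hbd]

section Area

variable [Finite V]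

theorem finite_support : Γ.support.Finite := by
  have : Γ.support = (⋃ v, Set.Icc (Γ.left v, Γ.row v) (Γ.right v, Γ.row v)) ∪
      ⋃ u, ⋃ v, ⋃ _ : G.Adj u v, Set.uIcc (Γ.att u v) (Γ.att v u) := by
    ext p
    simp [support]
  rw [this]
  exact (Set.finite_iUnion fun v => Set.finite_Icc _ _).union
    (Set.finite_iUnion fun u => Set.finite_iUnion fun v => Set.finite_iUnion fun _ =>
      Set.finite_Icc _ _)

theorem card_image_row_le_height (s : Finset V) : (s.image Γ.row).card ≤ Γ.height := by
  have hfin : {y : ℤ | ∃ x, (x, y) ∈ Γ.support}.Finite := by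
    refine (Γ.finite_support.image Prod.snd).subset ?_
    rintro y ⟨x, h⟩
    exact ⟨_, h, rfl⟩
  rw [← Set.ncard_coe_finset]
  refine Set.ncard_le_ncard ?_ hfin
  intro y hy
  obtain ⟨v, -, rfl⟩ := Finset.mem_image.1 (Finset.mem_coe.1 hy)
  exact ⟨Γ.left v, Or.inl ⟨v, ⟨le_rfl, le_rfl⟩, ⟨Γ.left_le_right v, le_rfl⟩⟩⟩

/-- Edges that leave a bar on the same side do so in different columns. -/
theorem card_le_width_of_same_side (v : V) (s : Finset V) (hs : ∀ a ∈ s, G.Adj v a)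
    (hside : (∀ a ∈ s, Γ.row v < Γ.row a) ∨ ∀ a ∈ s, Γ.row a < Γ.row v) :
    s.card ≤ Γ.width := by
  have hfin : {x : ℤ | ∃ y, (x, y) ∈ Γ.support}.Finite := by
    refine (Γ.finite_support.image Prod.fst).subset ?_
    rintro x ⟨y, h⟩
    exact ⟨_, h, rfl⟩
  have hne : ∀ a ∈ s, Γ.row v ≠ Γ.row a := fun a ha => by
    rcases hside with h | h
    · exact (h a ha).ne
    · exact (h a ha).ne'
  have key : ∀ a ∈ s, ∀ b ∈ s, a ≠ b → (Γ.att v a).1 = (Γ.att v b).1 →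
      ¬ (Γ.row v < Γ.row a ∧ Γ.row a ≤ Γ.row b ∨ Γ.row b ≤ Γ.row a ∧ Γ.row a < Γ.row v) := by
    intro a ha b hb hab hx hrow
    have e1 := Γ.att_fst_eq (hs a ha) (hne a ha)
    have e2 := Γ.att_fst_eq (hs b hb) (hne b hb)
    have e3 := Γ.left_le_att (hs a ha).symm
    have e4 := Γ.att_le_right (hs a ha).symm
    refine Set.disjoint_left.1 (Γ.edge_disjoint_bar v b a (hs b hb) (hs a ha).ne' hab)
      (show ((Γ.att v a).1, Γ.row a) ∈ _ from ?_)
      ⟨⟨by simpa [e1] using e3, le_rfl⟩, ⟨by simpa [e1] using e4, le_rfl⟩⟩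
    rw [Set.uIcc, Set.mem_Icc, Prod.le_def, Prod.le_def]
    simp only [Prod.fst_inf, Prod.snd_inf, Prod.fst_sup, Prod.snd_sup, Γ.att_snd (hs b hb),
      Γ.att_snd (hs b hb).symm]
    omega
  have hinj : Set.InjOn (fun a => (Γ.att v a).1) s := by
    intro a ha b hb hx
    by_contra hab
    have k1 := key a ha b hb hab hx
    have k2 := key b hb a ha (Ne.symm hab) hx.symm
    rcases hside with h | h
    · have := h a ha
      have := h b hb
      omega
    · have := h a ha
      have := h b hb
      omega
  rw [← Finset.card_image_of_injOn hinj, ← Set.ncard_coe_finset]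
  refine Set.ncard_le_ncard ?_ hfin
  intro x hx
  obtain ⟨a, ha, rfl⟩ := Finset.mem_image.1 (Finset.mem_coe.1 hx)
  exact ⟨(Γ.att v a).2, Or.inl ⟨v, Γ.att_mem_bar (hs a ha)⟩⟩

/-- At most two edges at a bar are horizontal, and two others share a column only if one leaves
upwards and the other downwards. -/
theorem card_le_two_mul_width (v : V) (s : Finset V) (hs : ∀ a ∈ s, G.Adj v a) :
    s.card ≤ 2 * Γ.width + 2 := by
  classical
  have h1 := Γ.card_le_width_of_same_side v (s.filter fun a => Γ.row v < Γ.row a)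
    (fun a ha => hs a (Finset.mem_filter.1 ha).1) (Or.inl fun a ha => (Finset.mem_filter.1 ha).2)
  have h2 := Γ.card_le_width_of_same_side v (s.filter fun a => Γ.row a < Γ.row v)
    (fun a ha => hs a (Finset.mem_filter.1 ha).1) (Or.inr fun a ha => (Finset.mem_filter.1 ha).2)
  have h3 : (s.filter fun a => Γ.row a = Γ.row v).card ≤ 2 := by
    by_contra! h
    obtain ⟨a, b, c, ha, hb, hc, hab, hac, hbc⟩ := Finset.two_lt_card_iff.1 h
    rw [Finset.mem_filter] at ha hb hc
    exact Γ.not_three_neighbors_in_row (hs a ha.1) (hs b hb.1) (hs c hc.1) hab hac hbc ha.2 hb.2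
      hc.2
  have hcover : s ⊆ (s.filter fun a => Γ.row v < Γ.row a) ∪
      (s.filter fun a => Γ.row a < Γ.row v) ∪ s.filter fun a => Γ.row a = Γ.row v := by
    intro a ha
    simp only [Finset.mem_union, Finset.mem_filter, ha, true_and]
    omega
  have h4 := Finset.card_le_card hcover
  have h5 := Finset.card_union_le ((s.filter fun a => Γ.row v < Γ.row a) ∪
      (s.filter fun a => Γ.row a < Γ.row v)) (s.filter fun a => Γ.row a = Γ.row v)
  have h6 := Finset.card_union_le (s.filter fun a => Γ.row v < Γ.row a)
      (s.filter fun a => Γ.row a < Γ.row v)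
  omega

end Area

end BarVisibilityRep

/-! ### Graphs that are unions of kites -/

/-- The quadruples `a < b < c < d` and `a' < b' < c' < d'` are separated: one of them lies in a
closed cyclic interval that is bounded by consecutive members of the other one. -/
def Separated (a b c d a' b' c' d' : ℕ) : Prop :=
  d' ≤ a ∨ d ≤ a' ∨ (a ≤ a' ∧ d' ≤ b) ∨ (b ≤ a' ∧ d' ≤ c) ∨ (c ≤ a' ∧ d' ≤ d) ∨
    (a' ≤ a ∧ d ≤ b') ∨ (b' ≤ a ∧ d ≤ c') ∨ (c' ≤ a ∧ d ≤ d')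

/-- A set of increasing quadruples of numbers below `n`, any two of which are equal or
separated. -/
structure IsKiteFamily (n : ℕ) (K : ℕ → ℕ → ℕ → ℕ → Prop) : Prop where
  increasing : ∀ {a b c d}, K a b c d → a < b ∧ b < c ∧ c < d ∧ d < n
  separated : ∀ {a b c d a' b' c' d'}, K a b c d → K a' b' c' d' →
    (a = a' ∧ b = b' ∧ c = c' ∧ d = d') ∨ Separated a b c d a' b' c' d'

/-- Two distinct numbers are adjacent if they belong to a common quadruple of `K`. -/
def KiteAdj (K : ℕ → ℕ → ℕ → ℕ → Prop) (x y : ℕ) : Prop :=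
  x ≠ y ∧ ∃ a b c d, K a b c d ∧ (x = a ∨ x = b ∨ x = c ∨ x = d) ∧
    (y = a ∨ y = b ∨ y = c ∨ y = d)

theorem KiteAdj.symm {K : ℕ → ℕ → ℕ → ℕ → Prop} {x y : ℕ} (h : KiteAdj K x y) :
    KiteAdj K y x := by
  obtain ⟨hne, a, b, c, d, hK, hx, hy⟩ := h
  exact ⟨hne.symm, a, b, c, d, hK, hy, hx⟩

/-- The graph on `{0, …, n - 1}` in which every quadruple of `K` spans a complete graph. -/
def kiteGraph (n : ℕ) (K : ℕ → ℕ → ℕ → ℕ → Prop) : SimpleGraph (Fin n) where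
  Adj x y := KiteAdj K x y
  symm := ⟨fun _ _ h => h.symm⟩
  loopless := ⟨fun _ h => h.1 rfl⟩

namespace IsKiteFamily

variable {n : ℕ} {K : ℕ → ℕ → ℕ → ℕ → Prop}

theorem kite_of_interleave (hK : IsKiteFamily n K) {x y x' y' : ℕ} (h : KiteAdj K x y)
    (h' : KiteAdj K x' y') (h₁ : x < x') (h₂ : x' < y) (h₃ : y < y') : K x x' y y' := by
  obtain ⟨-, a, b, c, d, hk, hx, hy⟩ := h
  obtain ⟨-, a', b', c', d', hk', hx', hy'⟩ := h'
  have hs := hK.increasing hk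
  have hs' := hK.increasing hk'
  rcases hK.separated hk hk' with ⟨rfl, rfl, rfl, rfl⟩ | hsep
  · have : x = a ∧ x' = b ∧ y = c ∧ y' = d := by omega
    obtain ⟨rfl, rfl, rfl, rfl⟩ := this
    exact hk
  · exfalso
    have hx1 : a ≤ x ∧ x ≤ d := by omega
    have hy1 : a ≤ y ∧ y ≤ d := by omega
    have hx2 : a' ≤ x' ∧ x' ≤ d' := by omega
    have hy2 : a' ≤ y' ∧ y' ≤ d' := by omega
    unfold Separated at hsep
    rcases hsep with h | h | h | h | h | h | h | h <;> omega

/-- A pair of numbers is a diagonal of at most one quadruple. -/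
theorem opposite_diagonal_unique (hK : IsKiteFamily n K) {x y w z w' z' : ℕ}
    (h : K x w y z ∨ K w x z y) (h' : K x w' y z' ∨ K w' x z' y) : w = w' ∧ z = z' := by
  rcases h with h | h <;> rcases h' with h' | h' <;>
  · have hs := hK.increasing h
    have hs' := hK.increasing h'
    have hsep := hK.separated h h'
    unfold Separated at hsep
    omega

end IsKiteFamily

theorem exists_lt_sym2_eq {n : ℕ} {u v : Fin n} (h : u ≠ v) :
    ∃ u' v' : Fin n, u' < v' ∧ s(u, v) = s(u', v') := by
  rcases lt_or_gt_of_ne h with h | h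
  · exact ⟨u, v, h, rfl⟩
  · exact ⟨v, u, h, Sym2.eq_swap⟩

theorem crossAt_parabolaDrawing_of_kite {n : ℕ} {K : ℕ → ℕ → ℕ → ℕ → Prop}
    (hK : IsKiteFamily n K) {a b c d : Fin n} (h : K a b c d) :
    ∃ p, (parabolaDrawing (kiteGraph n K)).toLayout.CrossAt a c b d p := by
  obtain ⟨h1, h2, h3, -⟩ := hK.increasing h
  have h1' : ((a : ℕ) : ℝ) < (b : ℕ) := by exact_mod_cast h1
  have h2' : ((b : ℕ) : ℝ) < (c : ℕ) := by exact_mod_cast h2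
  have h3' : ((c : ℕ) : ℝ) < (d : ℕ) := by exact_mod_cast h3
  obtain ⟨p, hp1, hp2⟩ := exists_mem_openSegment h1' h2' h3'
  refine ⟨p, ⟨by omega, _, _, _, _, h, by simp, by simp⟩,
    ⟨by omega, _, _, _, _, h, by simp, by simp⟩, hp1, hp2, ?_⟩
  have := det2_parabola (a : ℕ) (c : ℕ) (b : ℕ) (d : ℕ)
  refine this ▸ mul_ne_zero (mul_ne_zero ?_ ?_) ?_ <;> linarith

theorem kite_of_crossAt_parabolaDrawing {n : ℕ} {K : ℕ → ℕ → ℕ → ℕ → Prop}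
    (hK : IsKiteFamily n K) {u v w z : Fin n} {p : ℝ × ℝ} (huv : u < v) (hwz : w < z)
    (h : (parabolaDrawing (kiteGraph n K)).toLayout.CrossAt u v w z p) :
    K u w v z ∨ K w u z v := by
  obtain ⟨h1, h2, hp1, hp2, hdet⟩ := h
  have hdet' : det2 (parabolaPoint (v : ℕ) - parabolaPoint (u : ℕ))
    (parabolaPoint (z : ℕ) - parabolaPoint (w : ℕ)) ≠ 0 := hdet
  rw [det2_parabola] at hdet'
  rcases interleave_of_mem_openSegment (by exact_mod_cast huv) (by exact_mod_cast hwz) hp1 hp2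
    (right_ne_zero_of_mul hdet') with ⟨i1, i2, i3⟩ | ⟨i1, i2, i3⟩
  · exact Or.inl (hK.kite_of_interleave h1 h2 (by exact_mod_cast i1) (by exact_mod_cast i2)
      (by exact_mod_cast i3))
  · exact Or.inr (hK.kite_of_interleave h2 h1 (by exact_mod_cast i1) (by exact_mod_cast i2)
      (by exact_mod_cast i3))

theorem isOuter1Planar_parabolaDrawing {n : ℕ} {K : ℕ → ℕ → ℕ → ℕ → Prop}
    (hK : IsKiteFamily n K) : (parabolaDrawing (kiteGraph n K)).IsOuter1Planar := by
  refine ⟨?_, parabolaDrawing_mem_frontier _⟩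
  intro u v w z w' z' p p' h h'
  obtain ⟨u₁, v₁, huv, e1⟩ := exists_lt_sym2_eq h.1.ne
  obtain ⟨w₁, z₁, hwz, e2⟩ := exists_lt_sym2_eq h.2.1.ne
  obtain ⟨w₂, z₂, hwz', e3⟩ := exists_lt_sym2_eq h'.2.1.ne
  have k1 := kite_of_crossAt_parabolaDrawing hK huv hwz (h.of_sym2_eq (by rw [e1, e2]))
  have k2 := kite_of_crossAt_parabolaDrawing hK huv hwz' (h'.of_sym2_eq (by rw [e1, e3]))
  obtain ⟨e4, e5⟩ := hK.opposite_diagonal_unique k1 k2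
  rw [e2, e3, Fin.ext e4, Fin.ext e5]

theorem fst_lt_of_mem_openSegment {p q r : ℝ × ℝ} (h : p.1 < q.1)
    (hr : r ∈ openSegment ℝ p q) : p.1 < r.1 ∧ r.1 < q.1 := by
  obtain ⟨s, t, hs, ht, hst, rfl⟩ := hr
  obtain rfl : s = 1 - t := by linarith
  simp only [Prod.fst_add, Prod.smul_fst, smul_eq_mul]
  constructor <;> nlinarith

/-- The dummy vertex of a kite is joined to a corner in the planarization. -/
theorem pAdj_parabolaDrawing_of_kite {n : ℕ} {K : ℕ → ℕ → ℕ → ℕ → Prop}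
    (hK : IsKiteFamily n K) {a b c d : Fin n} (h : K a b c d) :
    (parabolaDrawing (kiteGraph n K)).toLayout.PAdj (Sum.inl a) (Sum.inr s(s(a, c), s(b, d))) := by
  obtain ⟨h1, h2, h3, -⟩ := hK.increasing h
  have hac : ((a : ℕ) : ℝ) < (c : ℕ) := by exact_mod_cast h1.trans h2
  have hbd : ((b : ℕ) : ℝ) < (d : ℕ) := by exact_mod_cast h2.trans h3
  have hne : ((a : ℕ) : ℝ) + (c : ℕ) < (b : ℕ) + (d : ℕ) := by
    exact_mod_cast add_lt_add h1 h3
  have coords : ∀ r, (parabolaDrawing (kiteGraph n K)).toLayout.CrossAt a c b d r →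
      ((a : ℕ) : ℝ) < r.1 ∧ r.1 < (c : ℕ) ∧
        r.1 * (((b : ℕ) : ℝ) + (d : ℕ) - ((a : ℕ) + (c : ℕ))) =
          (b : ℕ) * (d : ℕ) - (a : ℕ) * (c : ℕ) := by
    intro r hr
    obtain ⟨i1, i2, i3⟩ := (mem_openSegment_parabola hac).1 hr.2.2.1
    obtain ⟨-, -, i4⟩ := (mem_openSegment_parabola hbd).1 hr.2.2.2.1
    exact ⟨i1, i2, by linear_combination i3 - i4⟩
  obtain ⟨p, hp⟩ := crossAt_parabolaDrawing_of_kite hK h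
  obtain ⟨p1, p2, p3⟩ := coords p hp
  refine ⟨a, c, parabolaPoint (a : ℕ), p, hp.1, Or.inl ⟨rfl, rfl⟩,
    Or.inr (Or.inr ⟨b, d, hp, rfl⟩), fun he => ?_, left_mem_segment ℝ _ _, ?_⟩
  · rw [← he] at p1
    exact lt_irrefl _ p1
  · intro x r hr hmem
    obtain ⟨l1, l2⟩ := fst_lt_of_mem_openSegment (p := parabolaPoint (a : ℕ)) p1 hmem
    rcases hr with ⟨-, rfl⟩ | ⟨-, rfl⟩ | ⟨w, z, hc, -⟩
    · exact lt_irrefl _ l1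
    · exact lt_asymm p2 l2
    · have he := (isOuter1Planar_parabolaDrawing hK).1 _ _ _ _ _ _ _ _ hp hc
      obtain ⟨-, -, r3⟩ := coords r (hc.of_sym2_eq (by rw [he]))
      have := mul_right_cancel₀ (sub_pos.2 hne).ne' (r3.trans p3.symm)
      exact l2.ne this

theorem crossedRows_of_kite {n : ℕ} {K : ℕ → ℕ → ℕ → ℕ → Prop} (hK : IsKiteFamily n K)
    {Γ : BarVisibilityRep (kiteGraph n K)}
    (hΓ : Γ.EmbeddingPreserving (parabolaDrawing (kiteGraph n K))) {a b c d : Fin n}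
    (h : K a b c d) : CrossedRows (Γ.row a) (Γ.row b) (Γ.row c) (Γ.row d) := by
  obtain ⟨p, hp⟩ := Γ.toLayout.exists_crossAt_of_pAdj
    ((hΓ.2.1 _ _).2 (pAdj_parabolaDrawing_of_kite hK h))
  exact Γ.crossedRows_of_crossAt hp

/-! ### The staircase graph -/

/-- The kites of the block of the staircase graph that occupies the numbers `b, …, b + 6 * k + 6`.
Two kites form a fan around the vertex `0` (`fanLeft`, `fanRight`). The `i`-th rung of a ladder
joins `b + 2 + 3 * i` to `b + 6 * k + 3 - 3 * i`; consecutive rungs span a kite (`rung`), and so do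
consecutive vertices of either rail together with two vertices between them (`railLeft`,
`railRight`). The kite `start` hangs the ladder on the fan. -/
inductive BlockKite (k b : ℕ) : ℕ → ℕ → ℕ → ℕ → Prop
  | fanLeft : BlockKite k b 0 b (b + 1) (b + 2)
  | fanRight : BlockKite k b 0 (b + 2) (b + 6 * k + 5) (b + 6 * k + 6)
  | start : BlockKite k b (b + 2) (b + 6 * k + 3) (b + 6 * k + 4) (b + 6 * k + 5)
  | rung {i} (hi : i < k) :
      BlockKite k b (b + 2 + 3 * i) (b + 5 + 3 * i) (b + 6 * k - 3 * i) (b + 6 * k + 3 - 3 * i)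
  | railLeft {i} (hi : i < k) :
      BlockKite k b (b + 2 + 3 * i) (b + 3 + 3 * i) (b + 4 + 3 * i) (b + 5 + 3 * i)
  | railRight {i} (hi : i < k) :
      BlockKite k b (b + 6 * k - 3 * i) (b + 6 * k + 1 - 3 * i) (b + 6 * k + 2 - 3 * i)
        (b + 6 * k + 3 - 3 * i)

/-- The kites of the staircase graph: those of three consecutive blocks, which start at `1`,
`6 * k + 7` and `12 * k + 13`, and `k` further kites of the fan around `0`. -/
inductive StaircaseKite (k : ℕ) : ℕ → ℕ → ℕ → ℕ → Prop
  | block {b a₁ a₂ a₃ a₄} (hb : b = 1 ∨ b = 6 * k + 7 ∨ b = 12 * k + 13)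
      (h : BlockKite k b a₁ a₂ a₃ a₄) : StaircaseKite k a₁ a₂ a₃ a₄
  | tail {i} (hi : i < k) :
      StaircaseKite k 0 (18 * k + 19 + 2 * i) (18 * k + 20 + 2 * i) (18 * k + 21 + 2 * i)

theorem Separated.symm {a b c d a' b' c' d' : ℕ} (h : Separated a b c d a' b' c' d') :
    Separated a' b' c' d' a b c d := by
  unfold Separated at *
  tauto

theorem BlockKite.increasing {k b a₁ a₂ a₃ a₄ : ℕ} (hb : 0 < b) (h : BlockKite k b a₁ a₂ a₃ a₄) :
    a₁ < a₂ ∧ a₂ < a₃ ∧ a₃ < a₄ ∧ (a₁ = 0 ∨ b ≤ a₁) ∧ b ≤ a₂ ∧ a₄ ≤ b + 6 * k + 6 := by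
  cases h <;> omega

theorem BlockKite.separated_of_lt {k b b' a₁ a₂ a₃ a₄ c₁ c₂ c₃ c₄ : ℕ} (hb : 0 < b)
    (hbb : b + 6 * k + 6 ≤ b') (h : BlockKite k b a₁ a₂ a₃ a₄) (h' : BlockKite k b' c₁ c₂ c₃ c₄) :
    Separated a₁ a₂ a₃ a₄ c₁ c₂ c₃ c₄ := by
  have h1 := h.increasing hb
  have h2 := h'.increasing (by omega)
  rcases h2.2.2.2.1 with h3 | h3
  · exact Or.inr (Or.inr (Or.inr (Or.inr (Or.inr (Or.inl (by omega))))))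
  · exact Or.inr (Or.inl (by omega))

theorem BlockKite.separated {k b a₁ a₂ a₃ a₄ c₁ c₂ c₃ c₄ : ℕ}
    (h : BlockKite k b a₁ a₂ a₃ a₄) (h' : BlockKite k b c₁ c₂ c₃ c₄) :
    (a₁ = c₁ ∧ a₂ = c₂ ∧ a₃ = c₃ ∧ a₄ = c₄) ∨ Separated a₁ a₂ a₃ a₄ c₁ c₂ c₃ c₄ := by
  unfold Separated
  cases h <;> cases h' <;> omega

theorem isKiteFamily_staircaseKite (k : ℕ) : IsKiteFamily (20 * k + 20) (StaircaseKite k) where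
  increasing h := by
    rcases h with ⟨hb, h⟩ | hi
    · have := h.increasing (by omega)
      omega
    · omega
  separated {a b c d a' b' c' d'} h h' := by
    -- The fan behind the blocks is separated from every block.
    have block_tail : ∀ {b i a₁ a₂ a₃ a₄}, (b = 1 ∨ b = 6 * k + 7 ∨ b = 12 * k + 13) →
        BlockKite k b a₁ a₂ a₃ a₄ → Separated a₁ a₂ a₃ a₄ 0 (18 * k + 19 + 2 * i)
          (18 * k + 20 + 2 * i) (18 * k + 21 + 2 * i) := by
      intro b i a₁ a₂ a₃ a₄ hb h
      have := h.increasing (by omega)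
      exact Or.inr (Or.inr (Or.inr (Or.inr (Or.inr (Or.inl (by omega))))))
    rcases h with @⟨b₁, _, _, _, _, hb, h⟩ | @⟨i, hi⟩ <;>
      rcases h' with @⟨b₂, _, _, _, _, hb', h'⟩ | @⟨i', hi'⟩
    · have : b₁ = b₂ ∨ b₁ + 6 * k + 6 ≤ b₂ ∨ b₂ + 6 * k + 6 ≤ b₁ := by omega
      rcases this with rfl | hlt | hlt
      · exact h.separated h'
      · exact Or.inr (h.separated_of_lt (by omega) hlt h')
      · exact Or.inr (h'.separated_of_lt (by omega) hlt h).symm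
    · exact Or.inr (block_tail hb h)
    · exact Or.inr (block_tail hb' h').symm
    · unfold Separated
      omega

theorem KiteAdj.of_kite {K : ℕ → ℕ → ℕ → ℕ → Prop} {a b c d x y : ℕ} (h : K a b c d)
    (hne : x ≠ y) (hx : x = a ∨ x = b ∨ x = c ∨ x = d) (hy : y = a ∨ y = b ∨ y = c ∨ y = d) :
    KiteAdj K x y :=
  ⟨hne, a, b, c, d, h, hx, hy⟩

/-- The numbers `0, 1, …, 20 * k + 19` form a path in the staircase graph. -/
theorem kiteAdj_staircaseKite_succ {k x : ℕ} (hk : 0 < k) (hx : x + 1 < 20 * k + 20) :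
    KiteAdj (StaircaseKite k) x (x + 1) := by
  by_cases h1 : 18 * k + 19 ≤ x
  · exact .of_kite (.tail (i := (x - (18 * k + 19)) / 2) (by omega)) (by omega) (by omega)
      (by omega)
  obtain ⟨b, t, hb, ht, hxb⟩ : ∃ b t, (b = 1 ∨ b = 6 * k + 7 ∨ b = 12 * k + 13) ∧
      t < 6 * k + 6 ∧ (x = b + t ∨ x = 0 ∧ b = 1 ∧ t = 0) := by
    by_cases h2 : 12 * k + 13 ≤ x
    · exact ⟨_, x - (12 * k + 13), Or.inr (Or.inr rfl), by omega, by omega⟩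
    by_cases h3 : 6 * k + 7 ≤ x
    · exact ⟨_, x - (6 * k + 7), Or.inr (Or.inl rfl), by omega, by omega⟩
    · exact ⟨1, x - 1, Or.inl rfl, by omega, by omega⟩
  by_cases h2 : t < 2
  · exact .of_kite (.block hb .fanLeft) (by omega) (by omega) (by omega)
  by_cases h3 : t < 3 * k + 2
  · exact .of_kite (.block hb (.railLeft (i := (t - 2) / 3) (by omega))) (by omega) (by omega)
      (by omega)
  by_cases h4 : t = 3 * k + 2
  · exact .of_kite (.block hb (.rung (i := k - 1) (by omega))) (by omega) (by omega) (by omega)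
  by_cases h5 : t < 6 * k + 3
  · exact .of_kite (.block hb (.railRight (i := (6 * k + 2 - t) / 3) (by omega))) (by omega)
      (by omega) (by omega)
  by_cases h6 : t < 6 * k + 5
  · exact .of_kite (.block hb .start) (by omega) (by omega) (by omega)
  · exact .of_kite (.block hb .fanRight) (by omega) (by omega) (by omega)

theorem connected_staircaseGraph {k : ℕ} (hk : 0 < k) :
    (kiteGraph (20 * k + 20) (StaircaseKite k)).Connected := by
  refine (SimpleGraph.pathGraph_connected (20 * k + 19)).mono ?_
  intro u v h
  rcases SimpleGraph.pathGraph_adj.1 h with h | h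
  · have := kiteAdj_staircaseKite_succ hk (x := u) (by omega)
    rwa [h] at this
  · have := (kiteAdj_staircaseKite_succ hk (x := v) (by omega)).symm
    rwa [h] at this

/-! ### Rows of the staircase graph -/

/-- What a visibility representation says about the rows `r v` of the vertices of a union of kites:
in every kite exactly one diagonal is horizontal and separates the ends of the other one, and no
vertex has three neighbours in its own row. -/
structure IsRowAssignment (K : ℕ → ℕ → ℕ → ℕ → Prop) (r : ℕ → ℤ) : Prop where
  crossedRows : ∀ {a b c d}, K a b c d → CrossedRows (r a) (r b) (r c) (r d)
  not_three : ∀ {v x y z}, KiteAdj K v x → KiteAdj K v y → KiteAdj K v z → x ≠ y → x ≠ z → y ≠ z →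
    r x = r v → r y = r v → r z ≠ r v

/-- The vertex `v` has the two neighbours `x` and `y` in its own row. -/
structure Saturated (K : ℕ → ℕ → ℕ → ℕ → Prop) (r : ℕ → ℤ) (v x y : ℕ) : Prop where
  ne : x ≠ y
  adj_left : KiteAdj K v x
  adj_right : KiteAdj K v y
  row_left : r x = r v
  row_right : r y = r v

namespace IsRowAssignment

variable {K : ℕ → ℕ → ℕ → ℕ → Prop} {r : ℕ → ℤ}

/-- In a kite with a saturated first corner the other diagonal is horizontal. -/
theorem of_saturated_first (hr : IsRowAssignment K r) {a b c d x y : ℕ} (h : K a b c d)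
    (hs : Saturated K r a x y) (hac : a ≠ c) (hx : x ≠ c) (hy : y ≠ c) :
    r b = r d ∧ (r a < r b ∧ r b < r c ∨ r c < r b ∧ r b < r a) := by
  have := hr.not_three hs.adj_left hs.adj_right
    (.of_kite h hac (by simp) (by simp)) hs.ne hx hy hs.row_left hs.row_right
  exact (hr.crossedRows h).resolve_left fun h => this h.1.symm

/-- In a kite with a saturated last corner the other diagonal is horizontal. -/
theorem of_saturated_last (hr : IsRowAssignment K r) {a b c d x y : ℕ} (h : K a b c d)
    (hs : Saturated K r d x y) (hbd : b ≠ d) (hx : x ≠ b) (hy : y ≠ b) : r a = r c := by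
  have := hr.not_three hs.adj_left hs.adj_right
    (.of_kite h hbd.symm (by simp) (by simp)) hs.ne hx hy hs.row_left hs.row_right
  exact ((hr.crossedRows h).resolve_right fun h => this h.1).1

variable {k : ℕ}

/-- In one of the three blocks neither kite of the fan has a horizontal diagonal at `0`, which
saturates the vertex that they share. -/
theorem exists_saturated (hr : IsRowAssignment (StaircaseKite k) r) :
    ∃ b, (b = 1 ∨ b = 6 * k + 7 ∨ b = 12 * k + 13) ∧
      Saturated (StaircaseKite k) r (b + 2) b (b + 6 * k + 6) := by
  have key : ∀ b, (b = 1 ∨ b = 6 * k + 7 ∨ b = 12 * k + 13) →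
      Saturated (StaircaseKite k) r (b + 2) b (b + 6 * k + 6) ∨
        ∃ x, b ≤ x ∧ x < b + 6 * k + 6 ∧ KiteAdj (StaircaseKite k) 0 x ∧ r x = r 0 := by
    intro b hb
    have k1 : StaircaseKite k 0 b (b + 1) (b + 2) := .block hb .fanLeft
    have k2 : StaircaseKite k 0 (b + 2) (b + 6 * k + 5) (b + 6 * k + 6) := .block hb .fanRight
    rcases hr.crossedRows k1 with h1 | h1
    · exact Or.inr ⟨b + 1, by omega, by omega,
        .of_kite k1 (by omega) (by simp) (by simp), h1.1.symm⟩
    rcases hr.crossedRows k2 with h2 | h2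
    · exact Or.inr ⟨b + 6 * k + 5, by omega, by omega,
        .of_kite k2 (by omega) (by simp) (by simp), h2.1.symm⟩
    exact Or.inl ⟨by omega, .of_kite k1 (by omega) (by simp) (by simp),
      .of_kite k2 (by omega) (by simp) (by simp), h1.1, h2.1.symm⟩
  rcases key 1 (by omega) with h1 | ⟨x, hx1, hx2, hx3, hx4⟩
  · exact ⟨_, by omega, h1⟩
  rcases key (6 * k + 7) (by omega) with h2 | ⟨y, hy1, hy2, hy3, hy4⟩
  · exact ⟨_, by omega, h2⟩
  rcases key (12 * k + 13) (by omega) with h3 | ⟨z, hz1, hz2, hz3, hz4⟩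
  · exact ⟨_, by omega, h3⟩
  exact absurd hz4 (hr.not_three hx3 hy3 hz3 (by omega) (by omega) (by omega) hx4 hy4)

/-- The state of the `i`-th rung `uz` of the ladder in the block of `b`: `u` is saturated by
vertices outside of the rest of the ladder, and `z` has such a neighbour in its own row. -/
def RungForced (k b : ℕ) (r : ℕ → ℤ) (i : ℕ) : Prop :=
  (∃ x y, Saturated (StaircaseKite k) r (b + 2 + 3 * i) x y ∧
    (x < b + 2 + 3 * i ∨ b + 6 * k + 3 - 3 * i ≤ x) ∧
    (y < b + 2 + 3 * i ∨ b + 6 * k + 3 - 3 * i ≤ y)) ∧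
  ∃ w, b + 6 * k + 3 - 3 * i < w ∧ KiteAdj (StaircaseKite k) (b + 6 * k + 3 - 3 * i) w ∧
    r w = r (b + 6 * k + 3 - 3 * i)

theorem rungForced_zero (hr : IsRowAssignment (StaircaseKite k) r) {b : ℕ}
    (hb : b = 1 ∨ b = 6 * k + 7 ∨ b = 12 * k + 13)
    (hs : Saturated (StaircaseKite k) r (b + 2) b (b + 6 * k + 6)) : RungForced k b r 0 := by
  have k1 : StaircaseKite k (b + 2) (b + 6 * k + 3) (b + 6 * k + 4) (b + 6 * k + 5) :=
    .block hb .start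
  have h := hr.of_saturated_first k1 hs (by omega) (by omega) (by omega)
  exact ⟨⟨_, _, hs, by omega, by omega⟩, b + 6 * k + 5, by omega,
    .of_kite k1 (by omega) (by simp) (by simp), h.1.symm⟩

/-- A forced rung `uz` forces the next rung `u'z'`: as `u` is saturated, the diagonal `u'z` is
horizontal, and the row of `z` lies strictly between those of `u` and `z'`. -/
theorem RungForced.succ (hr : IsRowAssignment (StaircaseKite k) r) {b i : ℕ}
    (hb : b = 1 ∨ b = 6 * k + 7 ∨ b = 12 * k + 13) (hi : i < k) (h : RungForced k b r i) :
    RungForced k b r (i + 1) ∧ r (b + 2 + 3 * (i + 1)) = r (b + 6 * k + 3 - 3 * i) ∧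
      (r (b + 2 + 3 * i) < r (b + 6 * k + 3 - 3 * i) ∧
          r (b + 6 * k + 3 - 3 * i) < r (b + 6 * k + 3 - 3 * (i + 1)) ∨
        r (b + 6 * k + 3 - 3 * (i + 1)) < r (b + 6 * k + 3 - 3 * i) ∧
          r (b + 6 * k + 3 - 3 * i) < r (b + 2 + 3 * i)) := by
  obtain ⟨⟨x, y, hs, hx, hy⟩, w, hw, hzw, hrw⟩ := h
  have k1 : StaircaseKite k _ _ _ _ := .block hb (.rung hi)
  have k2 : StaircaseKite k _ _ _ _ := .block hb (.railLeft hi)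
  have k3 : StaircaseKite k _ _ _ _ := .block hb (.railRight hi)
  have e1 : b + 2 + 3 * (i + 1) = b + 5 + 3 * i := by ring
  have e2 : b + 6 * k + 3 - 3 * (i + 1) = b + 6 * k - 3 * i := by omega
  rw [RungForced, e1, e2]
  obtain ⟨h1, h2⟩ := hr.of_saturated_first k1 hs (by omega) (by omega) (by omega)
  obtain ⟨h3, -⟩ := hr.of_saturated_first k2 hs (by omega) (by omega) (by omega)
  have hs' : Saturated (StaircaseKite k) r (b + 6 * k + 3 - 3 * i) w (b + 5 + 3 * i) :=
    ⟨by omega, hzw, .of_kite k1 (by omega) (by simp) (by simp), hrw, h1⟩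
  have h4 := hr.of_saturated_last k3 hs' (by omega) (by omega) (by omega)
  refine ⟨⟨⟨b + 6 * k + 3 - 3 * i, b + 3 + 3 * i, ⟨by omega, ?_, ?_, h1.symm, h3⟩, by omega,
    by omega⟩, b + 6 * k + 2 - 3 * i, by omega, ?_, h4.symm⟩, h1, ?_⟩
  · exact .of_kite k1 (by omega) (by simp) (by simp)
  · exact .of_kite k2 (by omega) (by simp) (by simp)
  · exact .of_kite k3 (by omega) (by simp) (by simp)
  · rwa [h1] at h2

/-- The right ends of the rungs of one of the ladders lie in distinct rows. -/
theorem exists_injOn (hr : IsRowAssignment (StaircaseKite k) r) :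
    ∃ f : ℕ → ℕ, (∀ i ≤ k, f i < 20 * k + 20) ∧ Set.InjOn (fun i => r (f i)) (Set.Iic k) := by
  obtain ⟨b, hb, hs⟩ := hr.exists_saturated
  set u : ℕ → ℕ := fun i => b + 2 + 3 * i with hu
  set z : ℕ → ℕ := fun i => b + 6 * k + 3 - 3 * i with hz
  refine ⟨z, fun i _ => by simp only [hz]; omega, ?_⟩
  have forced : ∀ i ≤ k, RungForced k b r i := by
    intro i
    induction i with
    | zero => exact fun _ => hr.rungForced_zero hb hs
    | succ i ih => exact fun hi => (RungForced.succ hr hb hi (ih (by omega))).1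
  have step : ∀ i < k, r (u (i + 1)) = r (z i) ∧ (r (u i) < r (z i) ∧ r (z i) < r (z (i + 1)) ∨
      r (z (i + 1)) < r (z i) ∧ r (z i) < r (u i)) :=
    fun i hi => (RungForced.succ hr hb hi (forced i hi.le)).2
  -- The comparison of `u` and `z` is inherited along the ladder, so the staircase never turns.
  by_cases h0 : r (u 0) < r (z 0)
  · have hup : ∀ i ≤ k, r (u i) < r (z i) := by
      intro i
      induction i with
      | zero => exact fun _ => h0
      | succ i ih =>
        intro hi
        have h1 := ih (by omega)
        have h2 := step i hi
        omega
    refine StrictMonoOn.injOn (strictMonoOn_Iic_of_lt_succ fun i hi => ?_)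
    have h1 := hup i (by omega)
    have h2 := step i hi
    simp only [Nat.succ_eq_succ, Nat.succ_eq_add_one]
    omega
  · have hdown : ∀ i ≤ k, r (z i) ≤ r (u i) := by
      intro i
      induction i with
      | zero => exact fun _ => not_lt.1 h0
      | succ i ih =>
        intro hi
        have h1 := ih (by omega)
        have h2 := step i hi
        omega
    refine StrictAntiOn.injOn (strictAntiOn_Iic_of_succ_lt fun i hi => ?_)
    have h1 := hdown i (by omega)
    have h2 := step i hi
    simp only [Nat.succ_eq_succ, Nat.succ_eq_add_one]
    omega

end IsRowAssignment

/-- The rows of the vertices in an embedding-preserving representation of a kite graph, extended by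
`0` to all numbers. -/
theorem isRowAssignment_of_embeddingPreserving {n : ℕ} {K : ℕ → ℕ → ℕ → ℕ → Prop}
    (hK : IsKiteFamily n K) {Γ : BarVisibilityRep (kiteGraph n K)}
    (hΓ : Γ.EmbeddingPreserving (parabolaDrawing (kiteGraph n K))) :
    IsRowAssignment K fun x => if h : x < n then Γ.row ⟨x, h⟩ else 0 := by
  constructor
  · intro a b c d h
    have := hK.increasing h
    simp only [dif_pos (show a < n by omega), dif_pos (show b < n by omega),
      dif_pos (show c < n by omega), dif_pos (show d < n by omega)]
    exact crossedRows_of_kite hK hΓ h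
  · intro v x y z hx hy hz hxy hxz hyz
    have lt : ∀ {p q}, KiteAdj K p q → p < n ∧ q < n := by
      rintro p q ⟨-, a, b, c, d, h, hp, hq⟩
      have := hK.increasing h
      omega
    simp only [dif_pos (lt hx).1, dif_pos (lt hx).2, dif_pos (lt hy).2, dif_pos (lt hz).2]
    intro hrx hry hrz
    exact Γ.not_three_neighbors_in_row (v := ⟨v, (lt hx).1⟩) (a := ⟨x, (lt hx).2⟩)
      (b := ⟨y, (lt hy).2⟩) (c := ⟨z, (lt hz).2⟩) hx hy hz (by simpa using hxy)
      (by simpa using hxz) (by simpa using hyz) hrx hry hrz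

section Bounds

variable {k : ℕ} {Γ : BarVisibilityRep (kiteGraph (20 * k + 20) (StaircaseKite k))}

theorem le_height_staircaseGraph
    (hΓ : Γ.EmbeddingPreserving (parabolaDrawing (kiteGraph (20 * k + 20) (StaircaseKite k)))) :
    k + 1 ≤ Γ.height := by
  obtain ⟨f, hf, hinj⟩ :=
    (isRowAssignment_of_embeddingPreserving (isKiteFamily_staircaseKite k) hΓ).exists_injOn
  have hf' : ∀ i : Fin (k + 1), f i < 20 * k + 20 := fun i => hf i (by omega)
  have hcard : ((Finset.univ.image fun i : Fin (k + 1) =>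
      (⟨f i, hf' i⟩ : Fin (20 * k + 20))).image Γ.row).card = k + 1 := by
    rw [Finset.image_image, Finset.card_image_of_injective, Finset.card_univ, Fintype.card_fin]
    intro i j hij
    refine Fin.ext (hinj (Set.mem_Iic.2 (by omega)) (Set.mem_Iic.2 (by omega)) ?_)
    simpa [hf' i, hf' j] using hij
  exact hcard ▸ Γ.card_image_row_le_height _

theorem le_width_staircaseGraph (hk : 0 < k) : k ≤ Γ.width := by
  let g : Fin (2 * k + 1) → Fin (20 * k + 20) := fun i => ⟨18 * k + 19 + i, by omega⟩
  have hg : Function.Injective g := fun i j h => by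
    have := Fin.mk.inj_iff.1 h
    omega
  have := Γ.card_le_two_mul_width ⟨0, by omega⟩ (Finset.univ.image g) fun a ha => by
    obtain ⟨i, -, rfl⟩ := Finset.mem_image.1 ha
    have hi := i.2
    show KiteAdj (StaircaseKite k) 0 (18 * k + 19 + i)
    by_cases h : (i : ℕ) < 2 * k
    · exact .of_kite (.tail (i := i / 2) (by omega)) (by omega) (by omega) (by omega)
    · exact .of_kite (.tail (i := k - 1) (by omega)) (by omega) (by omega) (by omega)
  rw [Finset.card_image_of_injective _ hg, Finset.card_univ, Fintype.card_fin] at this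
  omega

end Bounds

theorem theorem2 :
    ∃ c : ℝ, 0 < c ∧ ∀ N : ℕ, ∃ n : ℕ, N ≤ n ∧
      ∃ (G : SimpleGraph (Fin n)) (D : StraightLineDrawing G),
        G.Connected ∧ D.IsOuter1Planar ∧
          ∀ Γ : BarVisibilityRep G, Γ.EmbeddingPreserving D → c * (n : ℝ) ^ 2 ≤ (Γ.area : ℝ) := by
  refine ⟨1 / 1600, by norm_num, fun N => ?_⟩
  have hk : 0 < N + 1 := by omega
  refine ⟨20 * (N + 1) + 20, by omega, kiteGraph _ (StaircaseKite (N + 1)), parabolaDrawing _,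
    connected_staircaseGraph hk, isOuter1Planar_parabolaDrawing (isKiteFamily_staircaseKite _),
    fun Γ hΓ => ?_⟩
  have hw : N + 1 ≤ Γ.width := le_width_staircaseGraph hk
  have hh : N + 1 ≤ Γ.height := (Nat.le_succ _).trans (le_height_staircaseGraph hΓ)
  have harea : ((N : ℝ) + 1) * (N + 1) ≤ Γ.area := by exact_mod_cast Nat.mul_le_mul hw hh
  push_cast
  -- `20 * k + 20 ≤ 40 * k` for `k = N + 1`
  nlinarith [N.cast_nonneg (α := ℝ)]
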